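/- Let $I\subseteq\mathbb R$ be an interval of any type and let $f:I\to\mathbb R$ be operator convex, that is, $f$ is continuous and, for some infinite-dimensional complex Hilbert space $H$, $$f(\lambda x+(1-\lambda)y)\le\lambda f(x)+(1-\lambda)f(y)$$ for all $\lambda\in[0,1]$ and all bounded self-adjoint operators $x,y$ on $H$ with spectra in $I$ (where $x\le y$ means that $y-x$ is positive semi-definite). Let $\mathcal A$ and $\mathcal B$ be unital $C^*$-algebras, let $T$ be a locally compact Hausdorff space with a bounded (positive) Radon measure $\mu$, and let $(\phi_t)_{t\in T}$ be a unital field of positive linear maps $\phi_t:\mathcal A\to\mathcal B$; that is, $t\mapsto\phi_t(a)$ is norm continuous for every $a\in\mathcal A$, and $t\mapsto\phi_t(\mathbf 1)$ is Bochner integrable with $\int_T\phi_t(\mathbf 1)\,d\mu(t)=\mathbf 1$. Let $(x_t)_{t\in T}$ be a bounded norm continuous field of self-adjoint elements of $\mathcal A$ with spectra contained in $I$. Then: 1. $t\mapsto\phi_t(x_t)$ is Bochner integrable, and $\int_T\phi_t(x_t)\,d\mu(t)$ is self-adjoint with spectrum contained in $I$. 2. If $\sup_{t\in T}\|f(x_t)\|<\infty$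 (in particular, if all the spectra lie in one compact subset of $I$, which is automatic when $I$ is closed), then $t\mapsto\phi_t(f(x_t))$ is Bochner integrable. 3. Whenever $t\mapsto\phi_t(f(x_t))$ is Bochner integrable, $$f\Bigl(\int_T\phi_t(x_t)\,d\mu(t)\Bigr)\le\int_T\phi_t(f(x_t))\,d\mu(t).$$ -/

import Mathlib

open MeasureTheory

/-- `f` is operator convex on the set `I` (an interval in all uses), with respect to operators
acting on the complex Hilbert space `H`: `f` is continuous on `I` and
`f (l x + (1 - l) y) ≤ l f(x) + (1 - l) f(y)` for all bounded self-adjoint operators `x`, `y` on `H`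
with spectra in `I` and all `l ∈ [0, 1]`. Here `f (x)` is given by the continuous functional
calculus and `≤` is the Loewner order (`x ≤ y` iff `y - x` is positive semi-definite).
Only the values of `f` on `I` matter. -/
def OperatorConvexOn (H : Type*) [NormedAddCommGroup H] [InnerProductSpace ℂ H] [CompleteSpace H]
    (I : Set ℝ) (f : ℝ → ℝ) : Prop :=
  ContinuousOn f I ∧
    ∀ x y : H →L[ℂ] H, IsSelfAdjoint x → IsSelfAdjoint y →
      spectrum ℝ x ⊆ I → spectrum ℝ y ⊆ I → ∀ l ∈ Set.Icc (0 : ℝ) 1,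
        cfc f (l • x + (1 - l) • y) ≤ l • cfc f x + (1 - l) • cfc f y

/-- A (continuous) field `(φ t)` of positive linear maps between unital C⋆-algebras is unital with
respect to `μ`: the function `t ↦ φ t a` is norm continuous for each `a`, and `t ↦ φ t 1` is Bochner
integrable with integral `1`. -/
structure IsUnitalField {T A B : Type*} [TopologicalSpace T] [MeasurableSpace T]
    [CStarAlgebra A] [PartialOrder A] [StarOrderedRing A]
    [CStarAlgebra B] [PartialOrder B] [StarOrderedRing B]
    (μ : Measure T) (φ : T → A →ₚ[ℂ] B) : Prop where
  continuous_apply : ∀ a : A, Continuous fun t => φ t a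
  integrable_one : Integrable (fun t => φ t 1) μ
  integral_one : ∫ t, φ t 1 ∂μ = 1

/-!
The integral inequality reduces to the discrete one
`f (∑ r i • b i) ≤ ∑ f (r i) • b i` for positive `b i` in `B` with `∑ b i = 1` and `r i ∈ I`
(`OperatorConvexOn.cfc_sum_smul_le`).

*From discrete to continuous.* Suppose first that all spectra lie in `[p, q] ⊆ I`. Bernstein's
operators give a partition of unity `h k` and nodes `r k` in `[p, q]` such that `∑ r k h k` is
exactly the identity on `[p, q]` and `∑ f (r k) h k` is uniformly close to `f`
(`exists_partition_of_unity_approx`). With `b k = ∫ φ t (h k (x t))` the discrete inequality becomes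
the integral one up to `ε`. Only positivity of the maps `φ t` is used, since `b k` involves the
functional calculus of one element at a time. In general, `I` is exhausted by compact intervals; on
the set `S n` of those `t` for which the spectrum of `x t` lies in the `n`-th interval the above
applies, the missing mass `1 - ∫_{S n} φ t 1` being placed at a fixed point of `I`
(`OperatorConvexOn.cfc_setIntegral_add_le`), and `n → ∞` gives the claim, because the functional
calculus by `f` is continuous on the self-adjoint elements with spectrum in `I`
(`Filter.Tendsto.cfc_of_ordConnected`).

*The discrete inequality.* For an isometry `J` into `H` and a self-adjoint `X` on `H`, convexity at
the midpoint of `X` and `U X U`, where `U = 2 J J* - 1`, gives `f (J* X J) ≤ J* f (X) J`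
(`OperatorConvexOn.cfc_compression_le`). On a finite-dimensional space, a Naimark dilation of `b`
inside `H` turns this into the discrete inequality; here `H` has to be infinite-dimensional. On an
arbitrary Hilbert space one compresses to the span of finitely many vectors `S ^ j ξ`, with
`S = ∑ r i • b i`, and approximates `f` by polynomials. The `C⋆`-algebra `B` is reached through the
GNS representations of its positive functionals.

*The integral has its spectrum in `I`.* If all the spectra lie strictly above `s`, then so does that
of the integral (`IsUnitalField.notMem_spectrum_integral_of_lt`), and symmetrically from above.
-/

/-! ### Functional calculus and compressions of operators -/

/-- If a bounded operator intertwines two self-adjoint operators, then it intertwines their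
continuous functions. -/
lemma cfc_comp_eq_comp_cfc {E H : Type*}
    [NormedAddCommGroup E] [InnerProductSpace ℂ E] [CompleteSpace E]
    [NormedAddCommGroup H] [InnerProductSpace ℂ H] [CompleteSpace H]
    {J : E →L[ℂ] H} {Y : H →L[ℂ] H} {S : E →L[ℂ] E} (hY : IsSelfAdjoint Y) (hS : IsSelfAdjoint S)
    (h : Y ∘L J = J ∘L S) {f : ℝ → ℝ} {s : Set ℝ} (hs : IsCompact s) (hf : ContinuousOn f s)
    (hYs : spectrum ℝ Y ⊆ s) (hSs : spectrum ℝ S ⊆ s) :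
    cfc f Y ∘L J = J ∘L cfc f S := by
  have : CompactSpace s := isCompact_iff_compactSpace.mp hs
  have key : ∀ g : C(s, ℝ), cfcHomSuperset hY hYs g ∘L J = J ∘L cfcHomSuperset hS hSs g := by
    intro g
    induction g using ContinuousMap.induction_on_of_compact with
    | const r =>
      have : ContinuousMap.const s r = algebraMap ℝ C(s, ℝ) r := rfl
      rw [this, AlgHomClass.commutes, AlgHomClass.commutes]
      ext v
      simp [Algebra.algebraMap_eq_smul_one]
    | id => simpa only [cfcHomSuperset_id] using h
    | star_id => simpa only [star_trivial, cfcHomSuperset_id] using h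
    | add g k hg hk => simp only [map_add, ContinuousLinearMap.add_comp,
        ContinuousLinearMap.comp_add, hg, hk]
    | mul g k hg hk =>
      rw [map_mul, map_mul, ContinuousLinearMap.mul_def, ContinuousLinearMap.mul_def,
        ContinuousLinearMap.comp_assoc, hk, ← ContinuousLinearMap.comp_assoc, hg,
        ContinuousLinearMap.comp_assoc]
    | frequently g hg =>
      have hc : IsClosed {g : C(s, ℝ) |
          cfcHomSuperset hY hYs g ∘L J = J ∘L cfcHomSuperset hS hSs g} :=
        isClosed_eq ((cfcHomSuperset_continuous hY hYs).clm_comp continuous_const)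
          (continuous_const.clm_comp (cfcHomSuperset_continuous hS hSs))
      exact hc.mem_of_frequently_of_tendsto hg Filter.tendsto_id
  have := key ⟨_, hf.domRestrict⟩
  rw [cfcHomSuperset_apply, cfcHomSuperset_apply] at this
  rw [cfc_apply f Y hY (hf.mono hYs), cfc_apply f S hS (hf.mono hSs)]
  exact this

section Order

variable {B : Type*} [CStarAlgebra B] [PartialOrder B] [StarOrderedRing B]

lemma spectrum_subset_Icc_iff {x : B} (hx : IsSelfAdjoint x) {p q : ℝ} :
    spectrum ℝ x ⊆ Set.Icc p q ↔ algebraMap ℝ B p ≤ x ∧ x ≤ algebraMap ℝ B q := by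
  rw [algebraMap_le_iff_le_spectrum, le_algebraMap_iff_spectrum_le]
  exact ⟨fun h => ⟨fun t ht => (h ht).1, fun t ht => (h ht).2⟩, fun h t ht => ⟨h.1 t ht, h.2 t ht⟩⟩

end Order

section Compression

variable {H : Type*} [NormedAddCommGroup H] [InnerProductSpace ℂ H] [CompleteSpace H]
  {I : Set ℝ} {f : ℝ → ℝ}
  {E : Type*} [NormedAddCommGroup E] [InnerProductSpace ℂ E] [CompleteSpace E]

lemma adjoint_comp_comp_mono (J : E →L[ℂ] H) {X Y : H →L[ℂ] H} (h : X ≤ Y) :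
    J.adjoint ∘L X ∘L J ≤ J.adjoint ∘L Y ∘L J := by
  rw [ContinuousLinearMap.le_def] at h ⊢
  have := h.adjoint_conj J
  simpa only [ContinuousLinearMap.sub_comp, ContinuousLinearMap.comp_sub] using this

lemma spectrum_compression_subset {J : E →L[ℂ] H} (hJ : J.adjoint ∘L J = 1) {X : H →L[ℂ] H}
    (hX : IsSelfAdjoint X) {p q : ℝ} (h : spectrum ℝ X ⊆ Set.Icc p q) :
    IsSelfAdjoint (J.adjoint ∘L X ∘L J) ∧
      spectrum ℝ (J.adjoint ∘L X ∘L J) ⊆ Set.Icc p q := by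
  have hsa : IsSelfAdjoint (J.adjoint ∘L X ∘L J) := hX.adjoint_conj J
  refine ⟨hsa, (spectrum_subset_Icc_iff hsa).2 ?_⟩
  obtain ⟨h1, h2⟩ := (spectrum_subset_Icc_iff hX).1 h
  have hr : ∀ r : ℝ, J.adjoint ∘L algebraMap ℝ (H →L[ℂ] H) r ∘L J = algebraMap ℝ _ r := by
    intro r
    rw [Algebra.algebraMap_eq_smul_one, Algebra.algebraMap_eq_smul_one, ← hJ]
    ext v
    simp
  exact ⟨hr p ▸ adjoint_comp_comp_mono J h1, hr q ▸ adjoint_comp_comp_mono J h2⟩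

/-- Jensen's inequality for compressions. With the self-adjoint unitary `U = 2JJ* - 1`, the average
of `X` and `UXU` is intertwined by `J` with the compression `J*XJ`, and midpoint convexity at
`X`, `UXU` compresses to the claim. -/
lemma OperatorConvexOn.cfc_compression_le (hf : OperatorConvexOn H I f)
    {J : E →L[ℂ] H} (hJ : J.adjoint ∘L J = 1)
    {X : H →L[ℂ] H} (hX : IsSelfAdjoint X) {p q : ℝ} (hXs : spectrum ℝ X ⊆ Set.Icc p q)
    (hpq : Set.Icc p q ⊆ I) :
    cfc f (J.adjoint ∘L X ∘L J) ≤ J.adjoint ∘L cfc f X ∘L J := by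
  have hJ' : ∀ v, J.adjoint (J v) = v := fun v => congr($hJ v)
  obtain ⟨hS, hSs⟩ := spectrum_compression_subset hJ hX hXs
  -- `U` is `1` on the range of `J` and `-1` on its orthogonal complement.
  set U : H →L[ℂ] H := (2 : ℝ) • (J ∘L J.adjoint) - 1 with hU
  have hUJ : U ∘L J = J := by
    ext v
    simp [hU, hJ', two_smul]
  have hUsa : U.adjoint = U := by
    have : (J ∘L J.adjoint).adjoint = J ∘L J.adjoint := by
      rw [ContinuousLinearMap.adjoint_comp, ContinuousLinearMap.adjoint_adjoint]
    rw [hU, map_sub, ← ContinuousLinearMap.star_eq_adjoint, star_smul,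
      ContinuousLinearMap.star_eq_adjoint, this]
    simp [← ContinuousLinearMap.star_eq_adjoint]
  have hUU : U.adjoint ∘L U = 1 := by
    rw [hUsa]
    ext v
    have hUv : ∀ v, U v = J (J.adjoint v) + J (J.adjoint v) - v := fun v => by
      simp [hU, two_smul]
    simp only [ContinuousLinearMap.comp_apply, hUv, map_sub, map_add, hJ', one_apply_eq_self]
    abel
  have hJU : J.adjoint ∘L U = J.adjoint := by
    have := congr(ContinuousLinearMap.adjoint $hUJ)
    rwa [ContinuousLinearMap.adjoint_comp, hUsa] at this
  set Z : H →L[ℂ] H := U.adjoint ∘L X ∘L U with hZ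
  obtain ⟨hZsa, hZs⟩ := spectrum_compression_subset hUU hX hXs
  rw [← hZ] at hZsa hZs
  have hconv := hf.2 X Z hX hZsa (hXs.trans hpq) (hZs.trans hpq) (1 / 2) (by norm_num)
  set Y : H →L[ℂ] H := (1 / 2 : ℝ) • X + (1 - 1 / 2 : ℝ) • Z with hY
  have hYsa : IsSelfAdjoint Y :=
    ((IsSelfAdjoint.all _).smul hX).add ((IsSelfAdjoint.all _).smul hZsa)
  have hYs : spectrum ℝ Y ⊆ Set.Icc p q := by
    rw [spectrum_subset_Icc_iff hYsa]
    obtain ⟨h1, h2⟩ := (spectrum_subset_Icc_iff hX).1 hXs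
    obtain ⟨h3, h4⟩ := (spectrum_subset_Icc_iff hZsa).1 hZs
    have hr : ∀ r : ℝ, algebraMap ℝ (H →L[ℂ] H) r =
        (1 / 2 : ℝ) • algebraMap ℝ (H →L[ℂ] H) r + (1 - 1 / 2 : ℝ) • algebraMap ℝ _ r := by
      intro r
      rw [← add_smul]
      norm_num
    constructor
    · rw [hr p]
      exact add_le_add (smul_le_smul_of_nonneg_left h1 (by norm_num))
        (smul_le_smul_of_nonneg_left h3 (by norm_num))
    · rw [hr q]
      exact add_le_add (smul_le_smul_of_nonneg_left h2 (by norm_num))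
        (smul_le_smul_of_nonneg_left h4 (by norm_num))
  have hcont : ContinuousOn f (Set.Icc p q) := hf.1.mono hpq
  have hYJ : Y ∘L J = J ∘L (J.adjoint ∘L X ∘L J) := by
    ext v
    have h1 : ∀ v, U (J v) = J v := fun v => congr($hUJ v)
    simp only [hY, hZ, hUsa, ContinuousLinearMap.comp_apply, add_apply,
      smul_apply, h1]
    simp only [hU, ContinuousLinearMap.comp_apply, sub_apply,
      smul_apply, one_apply_eq_self]
    rw [smul_sub, smul_smul]
    norm_num
  -- `Y J = J (J* X J)` gives `J* f (Y) J = f (J* X J)`, and `Z U = U X` gives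
  -- `J* f (Z) J = J* f (X) J`.
  have h1 := cfc_comp_eq_comp_cfc hYsa hS hYJ isCompact_Icc hcont hYs hSs
  have hZU : Z ∘L U = U ∘L X := by
    rw [hZ, ContinuousLinearMap.comp_assoc, ContinuousLinearMap.comp_assoc]
    nth_rw 2 [← hUsa]
    rw [hUU, hUsa]
    rfl
  have h2 := cfc_comp_eq_comp_cfc hZsa hX hZU isCompact_Icc hcont hZs hXs
  have h3 := adjoint_comp_comp_mono J hconv
  have h4 : J.adjoint ∘L cfc f Z ∘L J = J.adjoint ∘L cfc f X ∘L J := by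
    conv_lhs => enter [2, 2]; rw [← hUJ]
    rw [← ContinuousLinearMap.comp_assoc (cfc f Z), h2, ← ContinuousLinearMap.comp_assoc,
      ← ContinuousLinearMap.comp_assoc, hJU, ContinuousLinearMap.comp_assoc]
  have h5 : J.adjoint ∘L ((1 / 2 : ℝ) • cfc f X + (1 - 1 / 2 : ℝ) • cfc f Z) ∘L J =
      J.adjoint ∘L cfc f X ∘L J := by
    have : J.adjoint ∘L ((1 / 2 : ℝ) • cfc f X + (1 - 1 / 2 : ℝ) • cfc f Z) ∘L J =
      (1 / 2 : ℝ) • (J.adjoint ∘L cfc f X ∘L J) +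
        (1 - 1 / 2 : ℝ) • (J.adjoint ∘L cfc f Z ∘L J) := by
      ext v
      simp
    rw [this, h4, ← add_smul]
    norm_num
  rw [h1, ← ContinuousLinearMap.comp_assoc, hJ, h5] at h3
  exact h3

end Compression

/-! ### Dilation of finite-dimensional positive operator valued measures -/

section Dilation

variable {H : Type*} [NormedAddCommGroup H] [InnerProductSpace ℂ H]

lemma exists_orthonormal_of_not_finiteDimensional (hH : ¬ FiniteDimensional ℂ H)
    (κ : Type*) [Finite κ] : ∃ e : κ → H, Orthonormal ℂ e := by
  let b := Module.Basis.ofVectorSpace ℂ H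
  have : Infinite (Module.Basis.ofVectorSpaceIndex ℂ H) := by
    rw [← not_finite_iff_infinite]
    intro h
    exact hH (Module.Finite.of_basis b)
  have hli : LinearIndependent ℂ (b ∘ Infinite.natEmbedding _) :=
    b.linearIndependent.comp _ (Infinite.natEmbedding _).injective
  have ho := InnerProductSpace.gramSchmidtNormed_orthonormal hli
  obtain ⟨n, ⟨g⟩⟩ := Finite.exists_equiv_fin κ
  exact ⟨_, ho.comp (fun k => (g k : ℕ)) (Fin.val_injective.comp g.injective)⟩

variable [CompleteSpace H]

/-- An infinite-dimensional Hilbert space contains finitely many mutually orthogonal isometric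
copies of any finite-dimensional one. -/
lemma exists_orthogonal_isometries (hH : ¬ FiniteDimensional ℂ H)
    (ι : Type*) [Finite ι] [DecidableEq ι]
    (E : Type*) [NormedAddCommGroup E] [InnerProductSpace ℂ E] [FiniteDimensional ℂ E]
    [CompleteSpace E] :
    ∃ W : ι → E →L[ℂ] H, ∀ i k, (W i).adjoint ∘L W k = if i = k then 1 else 0 := by
  let b := stdOrthonormalBasis ℂ E
  obtain ⟨e, he⟩ := exists_orthonormal_of_not_finiteDimensional hH
    (ι × Fin (Module.finrank ℂ E))
  let W : ι → E →L[ℂ] H := fun i =>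
    LinearMap.toContinuousLinearMap (b.toBasis.constr ℂ fun j => e (i, j))
  have hW : ∀ i j, W i (b j) = e (i, j) := fun i j => by
    simp [W]
  refine ⟨W, fun i k => ?_⟩
  have : ∀ m : Fin _, ((W i).adjoint ∘L W k) (b m) =
      (if i = k then 1 else 0 : E →L[ℂ] E) (b m) := by
    intro m
    refine InnerProductSpace.ext_inner_left_basis b.toBasis fun l => ?_
    rw [b.coe_toBasis, ContinuousLinearMap.comp_apply, ContinuousLinearMap.adjoint_inner_right,
      hW, hW, orthonormal_iff_ite.1 he]
    split_ifs with h1 h2 h2 <;> simp_all [orthonormal_iff_ite.1 b.orthonormal]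
  ext v
  exact congr($(b.toBasis.ext (f₁ := ((W i).adjoint ∘L W k).toLinearMap)
    (f₂ := (if i = k then 1 else 0 : E →L[ℂ] E).toLinearMap) (by simpa using this)) v)

variable {I : Set ℝ} {f : ℝ → ℝ} {ι : Type*} [Fintype ι]

/-- Jensen's inequality for the spectral sum `∑ r i b i` of a positive operator valued measure on a
finite-dimensional space. Through `J = ∑ W i b i ^ (1 / 2)` the `b i` become compressions of the
orthogonal projections `W i (W i)*` (Naimark's dilation), carried out inside `H`. -/
lemma OperatorConvexOn.cfc_sum_smul_le_of_finiteDimensional (hH : ¬ FiniteDimensional ℂ H)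
    (hf : OperatorConvexOn H I f)
    {E : Type*} [NormedAddCommGroup E] [InnerProductSpace ℂ E] [FiniteDimensional ℂ E]
    [CompleteSpace E] {b : ι → E →L[ℂ] E} (hb : ∀ i, 0 ≤ b i) (hb1 : ∑ i, b i = 1)
    {r : ι → ℝ} {p q : ℝ} (hpq : Set.Icc p q ⊆ I) (hle : p ≤ q) (hr : ∀ i, r i ∈ Set.Icc p q) :
    cfc f (∑ i, r i • b i) ≤ ∑ i, f (r i) • b i := by
  classical
  obtain ⟨W, hW⟩ := exists_orthogonal_isometries hH ι E
  have hW' : ∀ i k v, (W i).adjoint (W k v) = if i = k then v else 0 := fun i k v => by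
    have := congr($(hW i k) v)
    rw [ContinuousLinearMap.comp_apply] at this
    rw [this]
    split_ifs <;> rfl
  have hite : ∀ (i : ι) (k l : ι) (v : E),
      W i (if k = l then v else 0) = if k = l then W i v else 0 := fun i k l v => by
    split_ifs <;> simp
  let c : ι → E →L[ℂ] E := fun i => CFC.sqrt (b i)
  have hc : ∀ i v, c i (c i v) = b i v := fun i v => congr($(CFC.sqrt_mul_sqrt_self (b i) (hb i)) v)
  have hcsa : ∀ i, (c i).adjoint = c i := fun i => (CFC.sqrt_nonneg (b i)).isSelfAdjoint
  let J : E →L[ℂ] H := ∑ i, W i ∘L c i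
  have hJv : ∀ v, J v = ∑ i, W i (c i v) := fun v => by simp [J]
  have hJadj : ∀ w, J.adjoint w = ∑ i, c i ((W i).adjoint w) := fun w => by
    simp [J, map_sum, ContinuousLinearMap.adjoint_comp, hcsa]
  have hJJ : J.adjoint ∘L J = 1 := by
    rw [← hb1]
    ext v
    simp [hJadj, hJv, hW', hc]
  let P : ι → H →L[ℂ] H := fun i => W i ∘L (W i).adjoint
  have hP : ∀ i, 0 ≤ P i := fun i => by
    rw [ContinuousLinearMap.nonneg_iff_isPositive]
    exact ContinuousLinearMap.isPositive_self_comp_adjoint (W i)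
  have hPsum : ∑ i, P i ≤ 1 := by
    have hsa : IsSelfAdjoint (1 - ∑ i, P i) :=
      (IsSelfAdjoint.one _).sub (IsSelfAdjoint.of_nonneg (Finset.sum_nonneg fun i _ => hP i))
    have hmul : (1 - ∑ i, P i) * (1 - ∑ i, P i) = 1 - ∑ i, P i := by
      have : (∑ i, P i) * (∑ i, P i) = ∑ i, P i := by
        ext v
        simp [P, hW', hite]
      rw [mul_sub, sub_mul, sub_mul, this]
      simp
    rw [← sub_nonneg, ← hmul]
    nth_rw 1 [← hsa.star_eq]
    exact star_mul_self_nonneg _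
  -- `X` is `r i` on the range of `W i` and `p` on the complement of these ranges.
  let X : H →L[ℂ] H := algebraMap ℝ _ p + ∑ i, (r i - p) • P i
  have hXnn : algebraMap ℝ _ p ≤ X :=
    le_add_of_nonneg_right (Finset.sum_nonneg fun i _ => smul_nonneg (sub_nonneg.2 (hr i).1) (hP i))
  have hX : IsSelfAdjoint X := by
    have := (IsSelfAdjoint.of_nonneg (sub_nonneg.2 hXnn)).add
      (IsSelfAdjoint.algebraMap (H →L[ℂ] H) (IsSelfAdjoint.all p))
    rwa [sub_add_cancel] at this
  have hXs : spectrum ℝ X ⊆ Set.Icc p q := by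
    refine (spectrum_subset_Icc_iff hX).2 ⟨hXnn, ?_⟩
    calc X ≤ algebraMap ℝ _ p + ∑ i, (q - p) • P i := by
          refine add_le_add le_rfl (Finset.sum_le_sum fun i _ => ?_)
          exact smul_le_smul_of_nonneg_right (sub_le_sub_right (hr i).2 p) (hP i)
      _ ≤ algebraMap ℝ _ p + (q - p) • 1 := by
          rw [← Finset.smul_sum]
          exact add_le_add le_rfl (smul_le_smul_of_nonneg_left hPsum (sub_nonneg.2 hle))
      _ = algebraMap ℝ _ q := by
          rw [← Algebra.algebraMap_eq_smul_one, ← map_add]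
          simp
  have hcont : ContinuousOn f (Set.Icc p q) := hf.1.mono hpq
  have hXW : ∀ i, X ∘L W i = W i ∘L algebraMap ℝ _ (r i) := fun i => by
    ext v
    simp [X, P, hW', hite, Algebra.algebraMap_eq_smul_one, ← add_smul]
  have hfXW : ∀ i v, cfc f X (W i v) = f (r i) • W i v := fun i v => by
    have hs : spectrum ℝ (algebraMap ℝ (E →L[ℂ] E) (r i)) ⊆ Set.Icc p q := by
      have hsa := IsSelfAdjoint.algebraMap (E →L[ℂ] E) (IsSelfAdjoint.all (r i))
      rw [spectrum_subset_Icc_iff hsa]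
      exact ⟨algebraMap_mono _ (hr i).1, algebraMap_mono _ (hr i).2⟩
    have := cfc_comp_eq_comp_cfc hX (IsSelfAdjoint.algebraMap _ (IsSelfAdjoint.all (r i))) (hXW i)
      isCompact_Icc hcont hXs hs
    rw [cfc_algebraMap] at this
    simpa [Algebra.algebraMap_eq_smul_one] using congr($this v)
  have key := hf.cfc_compression_le hJJ hX hXs hpq
  have h1 : J.adjoint ∘L X ∘L J = ∑ i, r i • b i := by
    have hXW' : ∀ i v, X (W i v) = r i • W i v := fun i v => by
      simpa [Algebra.algebraMap_eq_smul_one] using congr($(hXW i) v)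
    ext v
    simp [hJv, hJadj, hXW', hW', hc]
  have h2 : J.adjoint ∘L cfc f X ∘L J = ∑ i, f (r i) • b i := by
    ext v
    simp [hJv, hJadj, hfXW, hW', hc]
  rwa [h1, h2] at key

end Dilation

/-! ### Positive operator valued measures on a Hilbert space -/

section Hilbert

variable {H : Type*} [NormedAddCommGroup H] [InnerProductSpace ℂ H] [CompleteSpace H]
  {I : Set ℝ} {f : ℝ → ℝ} {ι : Type*} [Fintype ι]

lemma sum_smul_mem_Icc {B : Type*} [CStarAlgebra B] [PartialOrder B] [StarOrderedRing B]
    {b : ι → B} (hb : ∀ i, 0 ≤ b i) (hb1 : ∑ i, b i = 1) {r : ι → ℝ} {p q : ℝ}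
    (hr : ∀ i, r i ∈ Set.Icc p q) :
    IsSelfAdjoint (∑ i, r i • b i) ∧ spectrum ℝ (∑ i, r i • b i) ⊆ Set.Icc p q := by
  have hsa : IsSelfAdjoint (∑ i, r i • b i) := by
    refine isSelfAdjoint_sum _ fun i _ => ?_
    exact (IsSelfAdjoint.all _).smul (IsSelfAdjoint.of_nonneg (hb i))
  refine ⟨hsa, (spectrum_subset_Icc_iff hsa).2 ?_⟩
  rw [Algebra.algebraMap_eq_smul_one, Algebra.algebraMap_eq_smul_one, ← hb1, Finset.smul_sum,
    Finset.smul_sum]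
  exact ⟨Finset.sum_le_sum fun i _ => smul_le_smul_of_nonneg_right (hr i).1 (hb i),
    Finset.sum_le_sum fun i _ => smul_le_smul_of_nonneg_right (hr i).2 (hb i)⟩

lemma re_inner_apply_mono {K : Type*} [NormedAddCommGroup K] [InnerProductSpace ℂ K]
    {X Y : K →L[ℂ] K} (h : X ≤ Y) (v : K) : (inner ℂ (X v) v).re ≤ (inner ℂ (Y v) v).re := by
  rw [ContinuousLinearMap.le_def] at h
  simpa [inner_sub_left] using h.re_inner_nonneg_left v

lemma abs_re_inner_cfc_sub_aeval_le {K : Type*} [NormedAddCommGroup K] [InnerProductSpace ℂ K]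
    [CompleteSpace K] {S : K →L[ℂ] K} (hS : IsSelfAdjoint S) {s : Set ℝ} (hSs : spectrum ℝ S ⊆ s)
    (hf : ContinuousOn f s) {g : Polynomial ℝ} {δ : ℝ} (hg : ∀ t ∈ s, |g.eval t - f t| < δ)
    (v : K) :
    |(inner ℂ (cfc f S v) v).re - (inner ℂ (Polynomial.aeval S g v) v).re| ≤ δ * ‖v‖ ^ 2 := by
  have hcont := hf.mono hSs
  have hup : cfc f S ≤ Polynomial.aeval S g + algebraMap ℝ _ δ := by
    rw [← cfc_polynomial g S hS, ← cfc_const δ S hS, ← cfc_add _ _ _ (by fun_prop) (by fun_prop)]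
    refine cfc_mono (fun t ht => ?_) (by fun_prop) (by fun_prop)
    linarith [(abs_lt.1 (hg t (hSs ht))).1]
  have hlow : Polynomial.aeval S g ≤ cfc f S + algebraMap ℝ _ δ := by
    rw [← cfc_polynomial g S hS, ← cfc_const δ S hS, ← cfc_add _ _ _ hcont (by fun_prop)]
    refine cfc_mono (fun t ht => ?_) (by fun_prop) (by fun_prop)
    linarith [(abs_lt.1 (hg t (hSs ht))).2]
  have hδ : ∀ X : K →L[ℂ] K, (inner ℂ ((X + algebraMap ℝ _ δ) v) v).re =
      (inner ℂ (X v) v).re + δ * ‖v‖ ^ 2 := by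
    intro X
    have h1 : (algebraMap ℝ (K →L[ℂ] K) δ) v = (δ : ℂ) • v := by
      simp [Algebra.algebraMap_eq_smul_one]
    rw [add_apply, h1, inner_add_left, inner_smul_left, inner_self_eq_norm_sq_to_K]
    simp [← Complex.ofReal_pow]
  have e1 := re_inner_apply_mono hup v
  have e2 := re_inner_apply_mono hlow v
  rw [hδ] at e1 e2
  rw [abs_le]
  constructor <;> linarith

/-- On an arbitrary Hilbert space, the quadratic form of `f (S)` at `ξ` is approximated by that of a
polynomial in `S`, which only sees the compression of `S` to the span of finitely many `S ^ j ξ`. -/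
lemma OperatorConvexOn.cfc_sum_smul_le_of_hilbert (hH : ¬ FiniteDimensional ℂ H)
    (hf : OperatorConvexOn H I f)
    {K : Type*} [NormedAddCommGroup K] [InnerProductSpace ℂ K] [CompleteSpace K]
    {b : ι → K →L[ℂ] K} (hb : ∀ i, 0 ≤ b i) (hb1 : ∑ i, b i = 1)
    {r : ι → ℝ} {p q : ℝ} (hpq : Set.Icc p q ⊆ I) (hle : p ≤ q) (hr : ∀ i, r i ∈ Set.Icc p q) :
    cfc f (∑ i, r i • b i) ≤ ∑ i, f (r i) • b i := by
  obtain ⟨hS, hSs⟩ := sum_smul_mem_Icc hb hb1 hr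
  set S := ∑ i, r i • b i with hSdef
  have hcont : ContinuousOn f (Set.Icc p q) := hf.1.mono hpq
  have hsaR : IsSelfAdjoint (∑ i, f (r i) • b i) := isSelfAdjoint_sum _ fun i _ =>
    (IsSelfAdjoint.all _).smul (IsSelfAdjoint.of_nonneg (hb i))
  rw [ContinuousLinearMap.le_def, ContinuousLinearMap.isPositive_def']
  refine ⟨hsaR.sub (cfc_predicate f S), fun ξ => ?_⟩
  refine le_of_forall_pos_le_add fun ε hε => ?_
  obtain ⟨δ, hδ, hδε⟩ : ∃ δ : ℝ, 0 < δ ∧ 2 * δ * ‖ξ‖ ^ 2 ≤ ε := by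
    refine ⟨ε / (2 * (‖ξ‖ ^ 2 + 1)), by positivity, ?_⟩
    rw [mul_div_assoc', div_mul_eq_mul_div, div_le_iff₀ (by positivity)]
    nlinarith [sq_nonneg ‖ξ‖]
  obtain ⟨g, hg⟩ := exists_polynomial_near_of_continuousOn p q f hcont δ hδ
  obtain ⟨E, hfin, hE⟩ : ∃ E : Submodule ℂ K, FiniteDimensional ℂ E ∧
      ∀ j ≤ g.natDegree, (S ^ j) ξ ∈ E :=
    ⟨Submodule.span ℂ (Set.range fun j : Fin (g.natDegree + 1) => (S ^ (j : ℕ)) ξ),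
      FiniteDimensional.span_of_finite ℂ (Set.finite_range _),
      fun j hj => Submodule.subset_span ⟨⟨j, Nat.lt_succ_of_le hj⟩, rfl⟩⟩
  have : CompleteSpace E := FiniteDimensional.complete ℂ E
  let V : E →L[ℂ] K := E.subtypeL
  have hV : V.adjoint ∘L V = 1 := by
    refine ContinuousLinearMap.ext fun v => ext_inner_left ℂ fun w => ?_
    rw [ContinuousLinearMap.comp_apply, ContinuousLinearMap.adjoint_inner_right]
    rfl
  have hVV : ∀ w ∈ E, V (V.adjoint w) = w := fun w hw => by
    have := congr($hV ⟨w, hw⟩)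
    exact congr_arg V this
  let c : ι → E →L[ℂ] E := fun i => V.adjoint ∘L b i ∘L V
  have hc : ∀ i, 0 ≤ c i := fun i => by
    have := (ContinuousLinearMap.nonneg_iff_isPositive _).1 (hb i)
    exact (ContinuousLinearMap.nonneg_iff_isPositive _).2 (this.adjoint_conj V)
  have hc1 : ∑ i, c i = 1 := by
    rw [← hV]
    ext v
    have := congr($hb1 (V v))
    rw [sum_apply] at this
    simp only [c, sum_apply, ContinuousLinearMap.comp_apply, ← map_sum, this,
      one_apply_eq_self]
  obtain ⟨hS', hSs'⟩ := sum_smul_mem_Icc (B := E →L[ℂ] E) hc hc1 hr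
  have hmain := hf.cfc_sum_smul_le_of_finiteDimensional hH hc hc1 hpq hle hr
  set S' := ∑ i, r i • c i with hS'def
  have hSS' : ∀ v, S' v = V.adjoint (S (V v)) := fun v => by
    simp [hS'def, hSdef, c, map_sum]
  let ξ' : E := V.adjoint ξ
  have hξ' : V ξ' = ξ := hVV ξ (by simpa using hE 0 (Nat.zero_le _))
  -- `E` contains the orbit of `ξ` under `S` up to the degree of `g`, so that compressing to `E`
  -- changes neither these powers nor `g (S) ξ`.
  have hpow : ∀ j ≤ g.natDegree, V ((S' ^ j) ξ') = (S ^ j) ξ := by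
    intro j
    induction j with
    | zero => intro _; simpa using hξ'
    | succ j ih =>
      intro hj
      have h2 : S ((S ^ j) ξ) = (S ^ (j + 1)) ξ := by rw [pow_succ']; rfl
      rw [pow_succ', ContinuousLinearMap.mul_def, ContinuousLinearMap.comp_apply, hSS',
        ih (by omega), h2, hVV _ (hE _ hj)]
  have hpoly : V (Polynomial.aeval S' g ξ') = Polynomial.aeval S g ξ := by
    rw [Polynomial.aeval_eq_sum_range, Polynomial.aeval_eq_sum_range,
      sum_apply, sum_apply, map_sum]
    refine Finset.sum_congr rfl fun j hj => ?_
    have := hpow j (Nat.lt_succ_iff.1 (Finset.mem_range.1 hj))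
    rw [smul_apply, smul_apply, V.map_smul_of_tower, this]
  have e1 := (abs_le.1 (abs_re_inner_cfc_sub_aeval_le hS hSs hcont hg ξ)).2
  have e2 := (abs_le.1 (abs_re_inner_cfc_sub_aeval_le hS' hSs' hcont hg ξ')).1
  have e3 := re_inner_apply_mono hmain ξ'
  have e4 : (inner ℂ (Polynomial.aeval S' g ξ') ξ').re =
      (inner ℂ (Polynomial.aeval S g ξ) ξ).re := by
    rw [← hpoly, ← hξ']
    rfl
  have e5 : (inner ℂ ((∑ i, f (r i) • c i) ξ') ξ').re =
      (inner ℂ ((∑ i, f (r i) • b i) ξ) ξ).re := by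
    have : (∑ i, f (r i) • c i) ξ' = V.adjoint ((∑ i, f (r i) • b i) ξ) := by
      simp [c, hξ', map_sum]
    rw [this, ContinuousLinearMap.adjoint_inner_left, hξ']
  have e6 : ‖ξ'‖ = ‖ξ‖ := by
    rw [← hξ']
    rfl
  rw [e6] at e2
  rw [ContinuousLinearMap.reApplyInnerSelf_apply, sub_apply, inner_sub_left, map_sub]
  change 0 ≤ (inner ℂ ((∑ i, f (r i) • b i) ξ) ξ).re - (inner ℂ (cfc f S ξ) ξ).re + ε
  linarith

end Hilbert

/-! ### Positive operator valued measures in a `C⋆`-algebra -/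

section

open scoped ComplexOrder

section States

variable {B : Type*} [CStarAlgebra B] [PartialOrder B] [StarOrderedRing B]

/-- Positive linear functionals detect positivity: a non-positive self-adjoint element is separated
by a real functional from the closed convex cone of positive elements, and composing that
functional with the real part `a ↦ (a + a*) / 2` makes its complexification positive. -/
lemma nonneg_of_forall_positive_functional {a : B} (ha : IsSelfAdjoint a)
    (h : ∀ ω : B →ₚ[ℂ] ℂ, 0 ≤ (ω a).re) : 0 ≤ a := by
  by_contra hneg
  obtain ⟨g, hg, hga⟩ := (ProperCone.positive ℝ B).hyperplane_separation_point (x₀ := a) (by simpa)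
  let k : Module.Dual ℝ B :=
    { toFun := fun b => g (realPart b : selfAdjoint B)
      map_add' := by simp
      map_smul' := by simp }
  have hk : ∀ b, IsSelfAdjoint b → k b = g b := fun b hb => congr_arg g hb.coe_realPart
  have hkI : ∀ b, IsSelfAdjoint b → k (Complex.I • b) = 0 := fun b hb => by
    change g (realPart (Complex.I • b) : selfAdjoint B) = 0
    rw [realPart_I_smul, hb.imaginaryPart]
    simp
  let ω : B →ₚ[ℂ] ℂ := PositiveLinearMap.mk₀ (k.extendRCLike (𝕜 := ℂ)) fun b hb => by
    have hsa := IsSelfAdjoint.of_nonneg hb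
    have : k.extendRCLike (𝕜 := ℂ) b = (k b : ℂ) - Complex.I * (k (Complex.I • b) : ℂ) := rfl
    rw [this, hkI b hsa, hk b hsa]
    simpa using hg b hb
  have h1 : (ω a).re = k a := Module.Dual.re_extendRCLike_apply (𝕜 := ℂ) k a
  have h2 := h ω
  rw [h1, hk a ha] at h2
  exact absurd hga (not_lt.2 h2)

end States

section Discrete

variable {H : Type*} [NormedAddCommGroup H] [InnerProductSpace ℂ H] [CompleteSpace H]
  {I : Set ℝ} {f : ℝ → ℝ} {ι : Type*} [Fintype ι]
  {B : Type*} [CStarAlgebra B] [PartialOrder B] [StarOrderedRing B]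

/-- Jensen's inequality for a discrete positive operator valued measure in a `C⋆`-algebra. -/
lemma OperatorConvexOn.cfc_sum_smul_le (hH : ¬ FiniteDimensional ℂ H)
    (hf : OperatorConvexOn H I f) {b : ι → B} (hb : ∀ i, 0 ≤ b i) (hb1 : ∑ i, b i = 1)
    {r : ι → ℝ} {p q : ℝ} (hpq : Set.Icc p q ⊆ I) (hle : p ≤ q) (hr : ∀ i, r i ∈ Set.Icc p q) :
    cfc f (∑ i, r i • b i) ≤ ∑ i, f (r i) • b i := by
  obtain ⟨hS, hSs⟩ := sum_smul_mem_Icc hb hb1 hr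
  have hsaR : IsSelfAdjoint (∑ i, f (r i) • b i) := isSelfAdjoint_sum _ fun i _ =>
    (IsSelfAdjoint.all _).smul (IsSelfAdjoint.of_nonneg (hb i))
  have hcont : ContinuousOn f (spectrum ℝ (∑ i, r i • b i)) := (hf.1.mono hpq).mono hSs
  rw [← sub_nonneg]
  refine nonneg_of_forall_positive_functional (hsaR.sub (cfc_predicate f _)) fun ω => ?_
  let π := ω.gnsStarAlgHom
  have hπ : Continuous π := map_continuous π
  have hmain := hf.cfc_sum_smul_le_of_hilbert hH (b := fun i => π (b i))
    (fun i => map_nonneg π (hb i)) (by rw [← map_sum, hb1, map_one]) hpq hle hr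
  have hsum : ∀ c : ι → ℝ, ∑ i, c i • π (b i) = π (∑ i, c i • b i) := fun c => by
    rw [map_sum]
    refine Finset.sum_congr rfl fun i _ => ?_
    rw [← Complex.coe_smul, ← Complex.coe_smul, map_smul]
  rw [hsum, hsum, ← StarAlgHomClass.map_cfc π f _ hcont hπ hS (hS.map π)] at hmain
  have hξ : ∀ a : B, inner ℂ (π a (ω.toPreGNS 1 : ω.PreGNS))
      ((ω.toPreGNS 1 : ω.PreGNS) : ω.GNS) = ω (star a) := fun a => by
    simp [π, PositiveLinearMap.preGNS_inner_def]
  have := re_inner_apply_mono hmain ((ω.toPreGNS 1 : ω.PreGNS) : ω.GNS)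
  rw [hξ, hξ, hsaR.star_eq, (cfc_predicate f _ : IsSelfAdjoint _).star_eq] at this
  simpa using this

end Discrete

end

/-! ### Continuity, measurability and integrability of fields -/

section

open Filter Topology

section CfcContinuity

variable {B : Type*} [CStarAlgebra B]

/-- Near a point `p` of `I`, the set `I` is bounded below by one of its own points `p' ≤ p`: any point
of `I` below `p`, or `p` itself if there is none. -/
lemma exists_mem_le_and_lower_bound {I : Set ℝ} {p : ℝ} (hp : p ∈ I) :
    ∃ p' ∈ I, ∃ u < p, p' ≤ p ∧ ∀ t ∈ I, u < t → p' ≤ t := by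
  by_cases h : ∃ p' ∈ I, p' < p
  · obtain ⟨p', hp', hlt⟩ := h
    exact ⟨p', hp', p', hlt, hlt.le, fun t _ ht => ht.le⟩
  · push Not at h
    exact ⟨p, hp, p - 1, by linarith, le_rfl, fun t ht _ => h t ht⟩

lemma exists_mem_ge_and_upper_bound {I : Set ℝ} {q : ℝ} (hq : q ∈ I) :
    ∃ q' ∈ I, ∃ v > q, q ≤ q' ∧ ∀ t ∈ I, t < v → t ≤ q' := by
  by_cases h : ∃ q' ∈ I, q < q'
  · obtain ⟨q', hq', hlt⟩ := h
    exact ⟨q', hq', q', hlt, hlt.le, fun t _ ht => ht.le⟩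
  · push Not at h
    exact ⟨q, hq, q + 1, by linarith, le_rfl, fun t ht _ => h t ht⟩

/-- The continuous functional calculus by a function continuous on an interval `I` of any type is
continuous on the self-adjoint elements with spectrum in `I`: near a given element, the spectra stay
in a fixed compact subinterval of `I`. -/
lemma Filter.Tendsto.cfc_of_ordConnected {I : Set ℝ} (hI : I.OrdConnected) {f : ℝ → ℝ}
    (hf : ContinuousOn f I) {X : Type*} {l : Filter X} {a : X → B} {a₀ : B}
    (ha : Tendsto a l (𝓝 a₀)) (hsa : ∀ x, IsSelfAdjoint (a x)) (hspec : ∀ x, spectrum ℝ (a x) ⊆ I)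
    (hsa₀ : IsSelfAdjoint a₀) (hspec₀ : spectrum ℝ a₀ ⊆ I) :
    Tendsto (fun x => cfc f (a x)) l (𝓝 (cfc f a₀)) := by
  rcases subsingleton_or_nontrivial B with hB | hB
  · have : (fun x => cfc f (a x)) = fun _ => cfc f a₀ := funext fun x => Subsingleton.elim _ _
    rw [this]
    exact tendsto_const_nhds
  have hne : (spectrum ℝ a₀).Nonempty := ContinuousFunctionalCalculus.spectrum_nonempty a₀ hsa₀
  have hcpt : IsCompact (spectrum ℝ a₀) := ContinuousFunctionalCalculus.isCompact_spectrum a₀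
  obtain ⟨p, hp⟩ := hcpt.exists_isLeast hne
  obtain ⟨q, hq⟩ := hcpt.exists_isGreatest hne
  obtain ⟨p', hp', u, hu, hpp', hu'⟩ := exists_mem_le_and_lower_bound (hspec₀ hp.1)
  obtain ⟨q', hq', v, hv, hqq', hv'⟩ := exists_mem_ge_and_upper_bound (hspec₀ hq.1)
  have hnhds : Set.Ioo u v ∈ 𝓝ˢ (spectrum ℝ a₀) :=
    isOpen_Ioo.mem_nhdsSet.2 fun t ht => ⟨hu.trans_le (hp.2 ht), (hq.2 ht).trans_lt hv⟩
  have hev : ∀ᶠ x in l, Set.Ioo u v ∈ 𝓝ˢ (spectrum ℝ (a x)) :=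
    ha.eventually ((upperHemicontinuous_spectrum ℝ B) a₀ _ hnhds)
  refine ha.cfc (s := Set.Icc p' q') isCompact_Icc f ?_ (Eventually.of_forall hsa) ?_ hsa₀
    (hf.mono (hI.out hp' hq'))
  · filter_upwards [hev] with x hx t ht
    have h1 := subset_of_mem_nhdsSet hx ht
    exact ⟨hu' t (hspec x ht) h1.1, hv' t (hspec x ht) h1.2⟩
  · exact fun t ht => ⟨hpp'.trans (hp.2 ht), (hq.2 ht).trans hqq'⟩

lemma Continuous.cfc_of_ordConnected {I : Set ℝ} (hI : I.OrdConnected) {f : ℝ → ℝ}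
    (hf : ContinuousOn f I) {X : Type*} [TopologicalSpace X] {a : X → B}
    (ha : Continuous a) (hsa : ∀ x, IsSelfAdjoint (a x)) (hspec : ∀ x, spectrum ℝ (a x) ⊆ I) :
    Continuous fun x => cfc f (a x) :=
  continuous_iff_continuousAt.2 fun x =>
    (ha.tendsto x).cfc_of_ordConnected hI hf hsa hspec (hsa x) (hspec x)

end CfcContinuity

/-- A finite regular measure is carried by a countable union of compact sets, on each of which a
continuous function has separable range. -/
lemma Continuous.aestronglyMeasurable_of_regular {T E : Type*} [TopologicalSpace T] [T2Space T]
    [MeasurableSpace T] [BorelSpace T] (μ : Measure T) [IsFiniteMeasure μ] [μ.Regular]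
    [NormedAddCommGroup E] {g : T → E} (hg : Continuous g) : AEStronglyMeasurable g μ := by
  have h : ∀ n : ℕ, ∃ K ⊆ (Set.univ : Set T), IsCompact K ∧
      μ (Set.univ \ K) < (n + 1 : ENNReal)⁻¹ := fun n =>
    MeasurableSet.univ.exists_isCompact_sdiff_lt (measure_ne_top _ _) (by simp)
  choose K _ hK hμ using h
  have hnull : μ (⋃ n, K n)ᶜ = 0 := by
    refine le_antisymm (ENNReal.le_of_forall_pos_le_add fun ε hε _ => ?_) zero_le
    obtain ⟨n, hn⟩ := ENNReal.exists_inv_nat_lt (a := ε) (by simpa using hε.ne')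
    calc μ (⋃ n, K n)ᶜ ≤ μ (Set.univ \ K n) := by
          refine measure_mono ?_
          rw [← Set.compl_eq_univ_sdiff]
          exact Set.compl_subset_compl.2 (Set.subset_iUnion K n)
      _ ≤ (n + 1 : ENNReal)⁻¹ := (hμ n).le
      _ ≤ (n : ENNReal)⁻¹ := ENNReal.inv_le_inv.2 le_self_add
      _ ≤ 0 + ε := by simpa using hn.le
  have hres : μ.restrict (⋃ n, K n) = μ :=
    Measure.restrict_eq_self_of_ae_mem (by rw [ae_iff]; exact hnull)
  rw [← hres, aestronglyMeasurable_iUnion_iff]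
  exact fun n => hg.continuousOn.aestronglyMeasurable_of_isCompact (hK n) (hK n).measurableSet

section Fields

lemma IsSelfAdjoint.norm_le_of_spectrum_subset {B : Type*} [CStarAlgebra B] {b : B}
    (hb : IsSelfAdjoint b) {c : ℝ} (hc : 0 ≤ c)
    (h : spectrum ℝ b ⊆ Set.Icc (-c) c) : ‖b‖ ≤ c := by
  rw [← cfc_id ℝ b hb]
  exact norm_cfc_le hc fun t ht => abs_le.2 (h ht)

lemma PositiveLinearMap.map_algebraMap_real {A B : Type*} [CStarAlgebra A] [PartialOrder A]
    [CStarAlgebra B] [PartialOrder B] (φ : A →ₚ[ℂ] B) (r : ℝ) :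
    φ (algebraMap ℝ A r) = r • φ 1 := by
  rw [Algebra.algebraMap_eq_smul_one, ← Complex.coe_smul, map_smul, Complex.coe_smul]

variable {A B : Type*} [CStarAlgebra A] [PartialOrder A] [StarOrderedRing A]
  [CStarAlgebra B] [PartialOrder B] [StarOrderedRing B]

lemma PositiveLinearMap.norm_apply_le_of_isSelfAdjoint (φ : A →ₚ[ℂ] B) {a : A}
    (ha : IsSelfAdjoint a) : ‖φ a‖ ≤ ‖φ 1‖ * ‖a‖ := by
  have h1 : φ 1 ≤ algebraMap ℝ B ‖φ 1‖ :=
    IsSelfAdjoint.le_algebraMap_norm_self ((IsSelfAdjoint.one A).map φ)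
  have key : ∀ a : A, IsSelfAdjoint a → φ a ≤ algebraMap ℝ B (‖φ 1‖ * ‖a‖) := by
    intro a ha
    calc φ a ≤ φ (algebraMap ℝ A ‖a‖) := by
          gcongr
          exact ha.le_algebraMap_norm_self
      _ = ‖a‖ • φ 1 := φ.map_algebraMap_real _
      _ ≤ ‖a‖ • algebraMap ℝ B ‖φ 1‖ := smul_le_smul_of_nonneg_left h1 (norm_nonneg _)
      _ = algebraMap ℝ B (‖φ 1‖ * ‖a‖) := by
          rw [mul_comm, map_mul, Algebra.smul_def]
  have hsa := ha.map φ
  refine hsa.norm_le_of_spectrum_subset (by positivity)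
    ((spectrum_subset_Icc_iff hsa).2 ⟨?_, key a ha⟩)
  have := key (-a) ha.neg
  rw [map_neg, norm_neg, neg_le] at this
  rwa [map_neg]

variable {T : Type*} [TopologicalSpace T] [MeasurableSpace T] {μ : Measure T} {φ : T → A →ₚ[ℂ] B}

/-- Positive maps are bounded by their values at `1`, so strong continuity of `t ↦ φ t` is enough
for joint continuity along a continuous field. -/
lemma IsUnitalField.continuous_apply_field (hφ : IsUnitalField μ φ) {y : T → A} (hy : Continuous y)
    (hsa : ∀ t, IsSelfAdjoint (y t)) : Continuous fun t => φ t (y t) := by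
  refine continuous_iff_continuousAt.2 fun s => ?_
  have h1 : Tendsto (fun t => φ t (y t - y s)) (𝓝 s) (𝓝 0) := by
    refine squeeze_zero_norm (fun t =>
      (φ t).norm_apply_le_of_isSelfAdjoint ((hsa t).sub (hsa s))) ?_
    have h2 : Tendsto (fun t => ‖φ t 1‖ * ‖y t - y s‖) (𝓝 s) (𝓝 (‖φ s 1‖ * ‖y s - y s‖)) :=
      ((hφ.continuous_apply 1).norm.mul (hy.sub continuous_const).norm).tendsto s
    simpa using h2
  have h3 := h1.add ((hφ.continuous_apply (y s)).tendsto s)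
  simpa [ContinuousAt] using h3

lemma IsUnitalField.integrable_apply_field [T2Space T] [BorelSpace T] [IsFiniteMeasure μ]
    [μ.Regular] (hφ : IsUnitalField μ φ) {y : T → A} (hy : Continuous y)
    (hsa : ∀ t, IsSelfAdjoint (y t)) (hbdd : ∃ C : ℝ, ∀ t, ‖y t‖ ≤ C) :
    Integrable (fun t => φ t (y t)) μ := by
  obtain ⟨C, hC⟩ := hbdd
  refine (hφ.integrable_one.norm.mul_const C).mono'
    ((hφ.continuous_apply_field hy hsa).aestronglyMeasurable_of_regular μ)
    (Eventually.of_forall fun t => ?_)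
  exact ((φ t).norm_apply_le_of_isSelfAdjoint (hsa t)).trans
    (mul_le_mul_of_nonneg_left (hC t) (norm_nonneg _))

end Fields

lemma isSelfAdjoint_integral {T B : Type*} [MeasurableSpace T] {μ : Measure T} [CStarAlgebra B]
    {g : T → B} (hsa : ∀ t, IsSelfAdjoint (g t)) :
    IsSelfAdjoint (∫ t, g t ∂μ) := by
  by_cases hg : Integrable g μ
  · have := (starL' ℝ : B ≃L[ℝ] B).toContinuousLinearMap.integral_comp_comm hg
    have h2 : ∀ t, (starL' ℝ : B ≃L[ℝ] B).toContinuousLinearMap (g t) = g t := fun t => hsa t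
    simp_rw [h2] at this
    exact this.symm
  · rw [integral_undef hg]
    exact IsSelfAdjoint.zero B

lemma tendsto_setIntegral_of_eventually_mem {T E : Type*} [MeasurableSpace T] {μ : Measure T}
    [NormedAddCommGroup E] [NormedSpace ℝ E] {g : T → E} (hg : Integrable g μ)
    {S : ℕ → Set T} (hS : ∀ n, MeasurableSet (S n)) (hmem : ∀ t, ∀ᶠ n in atTop, t ∈ S n) :
    Tendsto (fun n => ∫ t in S n, g t ∂μ) atTop (𝓝 (∫ t, g t ∂μ)) := by
  simp_rw [← integral_indicator (hS _)]
  refine tendsto_integral_of_dominated_convergence (fun t => ‖g t‖)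
    (fun n => hg.aestronglyMeasurable.indicator (hS n)) hg.norm
    (fun n => Eventually.of_forall fun t => norm_indicator_le_norm_self _ _)
    (Eventually.of_forall fun t => ?_)
  refine tendsto_const_nhds.congr' ?_
  filter_upwards [hmem t] with n hn
  rw [Set.indicator_of_mem hn]

end

/-! ### The spectrum of the integral of a field -/

section

open Filter Topology

section Spectrum

variable {A B : Type*} [CStarAlgebra A] [PartialOrder A] [StarOrderedRing A]
  [CStarAlgebra B] [PartialOrder B] [StarOrderedRing B]
  {T : Type*} [TopologicalSpace T] [MeasurableSpace T] {μ : Measure T} {φ : T → A →ₚ[ℂ] B}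

lemma measurableSet_algebraMap_le [BorelSpace T] {x : T → A} (hx : Continuous x) (r : ℝ) :
    MeasurableSet {t | algebraMap ℝ A r ≤ x t} :=
  (isClosed_le continuous_const hx).measurableSet

lemma measurableSet_le_algebraMap [BorelSpace T] {x : T → A} (hx : Continuous x) (r : ℝ) :
    MeasurableSet {t | x t ≤ algebraMap ℝ A r} :=
  (isClosed_le hx continuous_const).measurableSet

/-- Strict lower bounds of the spectra are inherited by the integral. The field exceeds
`s + 1 / (n + 1)` on sets increasing to `T`, and the integral of `φ t 1` over one of them is already
at least `1 / 2`. -/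
lemma IsUnitalField.notMem_spectrum_integral_of_lt [BorelSpace T] (hφ : IsUnitalField μ φ)
    {x : T → A} (hx : Continuous x) (hsa : ∀ t, IsSelfAdjoint (x t))
    (hint : Integrable (fun t => φ t (x t)) μ) {s : ℝ} (hs : ∀ t, ∀ r ∈ spectrum ℝ (x t), s < r) :
    s ∉ spectrum ℝ (∫ t, φ t (x t) ∂μ) := by
  let S : ℕ → Set T := fun n => {t | algebraMap ℝ A (s + 1 / ((n : ℝ) + 1)) ≤ x t}
  have hS : ∀ n, MeasurableSet (S n) := fun n => measurableSet_algebraMap_le hx _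
  have hmem : ∀ t, ∀ᶠ n in atTop, t ∈ S n := by
    intro t
    have hS' : ∀ n, t ∈ S n ↔ ∀ r ∈ spectrum ℝ (x t), s + 1 / ((n : ℝ) + 1) ≤ r := fun n =>
      algebraMap_le_iff_le_spectrum (hsa t)
    simp_rw [hS']
    rcases (spectrum ℝ (x t)).eq_empty_or_nonempty with h0 | h0
    · simp [h0]
    obtain ⟨m, hm⟩ :=
      (ContinuousFunctionalCalculus.isCompact_spectrum (R := ℝ) (x t)).exists_isLeast h0
    have hlim : Tendsto (fun n : ℕ => s + 1 / ((n : ℝ) + 1)) atTop (𝓝 (s + 0)) :=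
      tendsto_const_nhds.add tendsto_one_div_add_atTop_nhds_zero_nat
    have := hlim.eventually_lt_const (u := m) (by simpa using hs t m hm.1)
    filter_upwards [this] with n hn r hr using hn.le.trans (hm.2 hr)
  have hlim := tendsto_setIntegral_of_eventually_mem hφ.integrable_one hS hmem
  rw [hφ.integral_one] at hlim
  obtain ⟨n, hn⟩ :=
    (hlim.eventually (Metric.ball_mem_nhds _ (by norm_num : (0 : ℝ) < 1 / 2))).exists
  rw [dist_eq_norm, ← norm_neg, neg_sub] at hn
  have hφ1 : ∀ t, 0 ≤ φ t 1 := fun t => map_nonneg (φ t) zero_le_one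
  have hhalf : algebraMap ℝ B (1 / 2) ≤ ∫ t in S n, φ t 1 ∂μ := by
    have hsa1 : IsSelfAdjoint (1 - ∫ t in S n, φ t 1 ∂μ) :=
      (IsSelfAdjoint.one B).sub (isSelfAdjoint_integral fun t => IsSelfAdjoint.of_nonneg (hφ1 t))
    have h1 := hsa1.le_algebraMap_norm_self.trans (algebraMap_mono B hn.le)
    rw [sub_le_comm] at h1
    refine le_trans (le_of_eq ?_) h1
    rw [← map_one (algebraMap ℝ B), ← map_sub]
    norm_num
  set δ : ℝ := 1 / ((n : ℝ) + 1) with hδ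
  have hδ0 : 0 < δ := by positivity
  have hsx : ∀ t, algebraMap ℝ A s ≤ x t := fun t =>
    (algebraMap_le_iff_le_spectrum (hsa t)).2 fun r hr => (hs t r hr).le
  have hs1 : ∀ r : ℝ, Integrable (fun t => r • φ t 1) μ := fun r => hφ.integrable_one.smul r
  have hfield : Integrable (fun t => φ t (x t) - s • φ t 1) μ :=
    hint.sub (hs1 s)
  have hlow : algebraMap ℝ B (s + δ / 2) ≤ ∫ t, φ t (x t) ∂μ := by
    have h1 : (∫ t, φ t (x t) ∂μ) - algebraMap ℝ B s = ∫ t, (φ t (x t) - s • φ t 1) ∂μ := by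
      rw [integral_sub hint (hs1 s), integral_smul, hφ.integral_one,
        Algebra.algebraMap_eq_smul_one]
    have h2 : ∫ t in S n, (φ t (x t) - s • φ t 1) ∂μ ≤ ∫ t, (φ t (x t) - s • φ t 1) ∂μ := by
      refine setIntegral_le_integral hfield (Eventually.of_forall fun t => ?_)
      have : φ t (algebraMap ℝ A s) ≤ φ t (x t) := by
        gcongr
        exact hsx t
      rw [PositiveLinearMap.map_algebraMap_real] at this
      exact sub_nonneg.2 this
    have h3 : ∫ t in S n, δ • φ t 1 ∂μ ≤ ∫ t in S n, (φ t (x t) - s • φ t 1) ∂μ := by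
      refine setIntegral_mono_on (hs1 δ).integrableOn hfield.integrableOn (hS n)
        fun t ht => ?_
      have : φ t (algebraMap ℝ A (s + δ)) ≤ φ t (x t) := by
        gcongr
        exact ht
      rw [PositiveLinearMap.map_algebraMap_real, add_smul] at this
      exact le_sub_iff_add_le'.2 this
    have h4 : algebraMap ℝ B (δ / 2) ≤ ∫ t in S n, δ • φ t 1 ∂μ := by
      rw [integral_smul, div_eq_mul_one_div, map_mul, ← Algebra.smul_def]
      exact smul_le_smul_of_nonneg_left hhalf hδ0.le
    rw [map_add, ← le_sub_iff_add_le', h1]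
    exact (h4.trans h3).trans h2
  intro hmem'
  have := (algebraMap_le_iff_le_spectrum
    (isSelfAdjoint_integral fun t => (hsa t).map (φ t))).1 hlow s hmem'
  linarith

lemma IsUnitalField.spectrum_integral_subset [BorelSpace T] (hφ : IsUnitalField μ φ)
    {I : Set ℝ} (hI : I.OrdConnected)
    {x : T → A} (hx : Continuous x) (hsa : ∀ t, IsSelfAdjoint (x t))
    (hspec : ∀ t, spectrum ℝ (x t) ⊆ I) (hint : Integrable (fun t => φ t (x t)) μ) :
    spectrum ℝ (∫ t, φ t (x t) ∂μ) ⊆ I := by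
  intro s hs
  obtain ⟨p, hp, hps⟩ : ∃ p ∈ I, p ≤ s := by
    by_contra! h
    exact hφ.notMem_spectrum_integral_of_lt hx hsa hint (fun t r hr => h r (hspec t hr)) hs
  obtain ⟨q, hq, hsq⟩ : ∃ q ∈ I, s ≤ q := by
    by_contra! h
    have hneg : (fun t => φ t (-x t)) = fun t => -φ t (x t) := funext fun t => map_neg (φ t) _
    refine hφ.notMem_spectrum_integral_of_lt (x := fun t => -x t) (s := -s) hx.neg
      (fun t => (hsa t).neg) (hneg ▸ hint.neg) (fun t r hr => ?_) ?_
    · rw [← spectrum.neg_eq, Set.mem_neg] at hr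
      linarith [h _ (hspec t hr)]
    · rw [hneg, integral_neg, ← spectrum.neg_eq]
      simpa using hs
  exact hI.out hp hq ⟨hps, hsq⟩

end Spectrum

end

/-! ### The inequality over sets with spectra in a compact interval -/

section

open Filter Topology

/-- Bernstein's operators on `[p, q]`: a continuous function is uniformly approximated on `[p, q]`
by combinations `∑ f (r k) h k` for a partition of unity `h` with `∑ r k h k` the identity. The
functions `h k` are extended to `ℝ` as constants beyond the ends of `[p, q]`. -/
lemma exists_partition_of_unity_approx {p q : ℝ} (hle : p ≤ q) {f : ℝ → ℝ}
    (hf : ContinuousOn f (Set.Icc p q)) {ε : ℝ} (hε : 0 < ε) :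
    ∃ (n : ℕ) (h : Fin n → ℝ → ℝ) (r : Fin n → ℝ), (∀ k, Continuous (h k)) ∧
      (∀ k s, 0 ≤ h k s) ∧ (∀ s, ∑ k, h k s = 1) ∧ (∀ k, r k ∈ Set.Icc p q) ∧
      ∀ s ∈ Set.Icc p q, ∑ k, r k * h k s = s ∧ ∑ k, f (r k) * h k s ≤ f s + ε := by
  let e : unitInterval → ℝ := fun u => p + (q - p) * u
  have he : ∀ u, e u ∈ Set.Icc p q := fun u =>
    ⟨by have := mul_nonneg (sub_nonneg.2 hle) u.2.1; simp only [e]; linarith,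
      by have := mul_le_mul_of_nonneg_left u.2.2 (sub_nonneg.2 hle); simp only [e]; linarith⟩
  let F : C(unitInterval, ℝ) := ⟨fun u => f (e u), hf.comp_continuous (by fun_prop) he⟩
  have hlim := bernsteinApproximation_uniform F
  obtain ⟨n, hn, hn0⟩ := ((hlim.eventually (Metric.ball_mem_nhds _ hε)).and
    (eventually_gt_atTop 0)).exists
  -- If `p = q`, division by zero makes `u` constantly `0`, and `e (u s) = s` still holds at `p`.
  let u : ℝ → unitInterval := fun s => Set.projIcc 0 1 zero_le_one ((s - p) / (q - p))
  have heu : ∀ s ∈ Set.Icc p q, e (u s) = s := by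
    intro s hs
    rcases hle.eq_or_lt with rfl | hlt
    · have : s = p := le_antisymm hs.2 hs.1
      simp [e, this]
    · have h0 : 0 < q - p := sub_pos.2 hlt
      have h1 : (s - p) / (q - p) ∈ Set.Icc (0 : ℝ) 1 :=
        ⟨div_nonneg (sub_nonneg.2 hs.1) h0.le, (div_le_one h0).2 (by linarith [hs.2])⟩
      simp only [e, u, Set.projIcc_of_mem zero_le_one h1]
      field_simp
      ring
  refine ⟨n + 1, fun k s => bernstein n k (u s), fun k => e (bernstein.z k), fun k => ?_,
    fun k s => bernstein_nonneg, fun s => bernstein.probability n (u s), fun k => he _,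
    fun s hs => ⟨?_, ?_⟩⟩
  · have : Continuous u := continuous_projIcc.comp (by fun_prop)
    fun_prop
  · have h1 := congr_arg (Polynomial.eval (u s : ℝ)) (bernsteinPolynomial.sum_smul ℝ n)
    rw [Polynomial.eval_finsetSum, Finset.sum_range] at h1
    have h2 : ∑ k : Fin (n + 1), (bernstein.z k : ℝ) * bernstein n k (u s) = u s := by
      have hn' : (n : ℝ) ≠ 0 := by positivity
      have h3 : ∀ k : Fin (n + 1), (bernstein.z k : ℝ) * bernstein n k (u s) =
          (n : ℝ)⁻¹ * Polynomial.eval (u s : ℝ) ((k : ℕ) • bernsteinPolynomial ℝ n k) := by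
        intro k
        simp [bernstein.z, bernstein]
        ring
      rw [Finset.sum_congr rfl fun k _ => h3 k, ← Finset.mul_sum, h1]
      simp [hn']
    have h4 := bernstein.probability n (u s)
    calc ∑ k : Fin (n + 1), e (bernstein.z k) * bernstein n k (u s)
        = p * ∑ k : Fin (n + 1), bernstein n k (u s) +
          (q - p) * ∑ k : Fin (n + 1), (bernstein.z k : ℝ) * bernstein n k (u s) := by
          rw [Finset.mul_sum, Finset.mul_sum, ← Finset.sum_add_distrib]
          exact Finset.sum_congr rfl fun k _ => by simp only [e]; ring
      _ = e (u s) := by rw [h2, h4, mul_one]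
      _ = s := heu s hs
  · have h1 := (ContinuousMap.dist_lt_iff hε).1 hn (u s)
    rw [bernsteinApproximation.apply, Real.dist_eq] at h1
    have h2 : F (u s) = f s := congr_arg f (heu s hs)
    rw [h2] at h1
    have h3 := (abs_lt.1 h1).2
    have h4 : ∑ k : Fin (n + 1), f (e (bernstein.z k)) * bernstein n k (u s) =
        ∑ k : Fin (n + 1), bernstein n k (u s) • F (bernstein.z k) :=
      Finset.sum_congr rfl fun k _ => mul_comm _ _
    change ∑ k : Fin (n + 1), f (e (bernstein.z k)) * bernstein n k (u s) ≤ _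
    rw [h4]
    linarith

section Jensen

variable {H : Type*} [NormedAddCommGroup H] [InnerProductSpace ℂ H] [CompleteSpace H]
  {I : Set ℝ} {f : ℝ → ℝ}
  {A B : Type*} [CStarAlgebra A] [PartialOrder A] [StarOrderedRing A]
  [CStarAlgebra B] [PartialOrder B] [StarOrderedRing B]
  {T : Type*} [TopologicalSpace T] [T2Space T] [MeasurableSpace T] [BorelSpace T]
  {μ : Measure T} [IsFiniteMeasure μ] [μ.Regular] {φ : T → A →ₚ[ℂ] B}

/-- Jensen's inequality over a set `S` on which the spectra lie in a compact interval `[p, q]`, the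
mass missing from `S` being placed at a point `r₀` of `[p, q]`. -/
lemma OperatorConvexOn.cfc_setIntegral_add_le (hH : ¬ FiniteDimensional ℂ H)
    (hf : OperatorConvexOn H I f) (hφ : IsUnitalField μ φ) {x : T → A} (hx : Continuous x)
    (hsa : ∀ t, IsSelfAdjoint (x t)) {S : Set T} (hS : MeasurableSet S)
    {p q r₀ : ℝ} (hpq : Set.Icc p q ⊆ I) (hr₀ : r₀ ∈ Set.Icc p q)
    (hspec : ∀ t ∈ S, spectrum ℝ (x t) ⊆ Set.Icc p q)
    (hfint : IntegrableOn (fun t => φ t (cfc f (x t))) S μ) :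
    spectrum ℝ ((∫ t in S, φ t (x t) ∂μ) + r₀ • (1 - ∫ t in S, φ t 1 ∂μ)) ⊆ Set.Icc p q ∧
    cfc f ((∫ t in S, φ t (x t) ∂μ) + r₀ • (1 - ∫ t in S, φ t 1 ∂μ)) ≤
      (∫ t in S, φ t (cfc f (x t)) ∂μ) + f r₀ • (1 - ∫ t in S, φ t 1 ∂μ) := by
  have hle : p ≤ q := hr₀.1.trans hr₀.2
  have hcont : ContinuousOn f (Set.Icc p q) := hf.1.mono hpq
  have hφ1 : ∀ t, 0 ≤ φ t 1 := fun t => map_nonneg (φ t) zero_le_one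
  have hS1 : ∫ t in S, φ t 1 ∂μ ≤ 1 := by
    rw [← hφ.integral_one]
    exact setIntegral_le_integral hφ.integrable_one (Eventually.of_forall hφ1)
  have hsmul : ∀ (t : T) (c : ℝ) (a : A), φ t (c • a) = c • φ t a := fun t c a => by
    rw [← Complex.coe_smul, map_smul, Complex.coe_smul]
  have hint1 : ∀ r : ℝ, Integrable (fun t => r • φ t 1) μ := fun r => hφ.integrable_one.smul r
  set c₀ : B := 1 - ∫ t in S, φ t 1 ∂μ with hc₀
  have key : ∀ ε : ℝ, 0 < ε →
      spectrum ℝ ((∫ t in S, φ t (x t) ∂μ) + r₀ • c₀) ⊆ Set.Icc p q ∧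
      cfc f ((∫ t in S, φ t (x t) ∂μ) + r₀ • c₀) ≤
        (∫ t in S, φ t (cfc f (x t)) ∂μ) + f r₀ • c₀ + ε • 1 := by
    intro ε hε
    obtain ⟨n, h, r, hhc, hh0, hh1, hr, happ⟩ := exists_partition_of_unity_approx hle hcont hε
    have hhint : ∀ k, Integrable (fun t => φ t (cfc (h k) (x t))) μ := by
      intro k
      refine hφ.integrable_apply_field
        (hx.cfc_of_ordConnected Set.ordConnected_univ (hhc k).continuousOn hsa
          fun t => Set.subset_univ _) (fun t => cfc_predicate _ _) ⟨1, fun t => ?_⟩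
      refine norm_cfc_le zero_le_one fun s _ => ?_
      rw [Real.norm_of_nonneg (hh0 k s), ← hh1 s]
      exact Finset.single_le_sum (fun j _ => hh0 j s) (Finset.mem_univ k)
    have hpt : ∀ (c : Fin n → ℝ) (t : T), φ t (cfc (fun s => ∑ k, c k * h k s) (x t)) =
        ∑ k, c k • φ t (cfc (h k) (x t)) := by
      intro c t
      have h1 : cfc (fun s => ∑ k, c k * h k s) (x t) = ∑ k, c k • cfc (h k) (x t) := by
        have := cfc_sum_univ (fun k s => c k * h k s) (x t) fun k =>
          (continuous_const.mul (hhc k)).continuousOn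
        rw [show (fun s => ∑ k, c k * h k s) = ∑ k, fun s => c k * h k s by ext; simp, this]
        exact Finset.sum_congr rfl fun k _ =>
          cfc_const_mul (c k) (h k) (x t) (hhc k).continuousOn
      rw [h1, map_sum]
      exact Finset.sum_congr rfl fun k _ => hsmul t _ _
    have hcint : ∀ (c : Fin n → ℝ) (k : Fin n),
        Integrable (fun t => c k • φ t (cfc (h k) (x t))) μ := fun c k => (hhint k).smul (c k)
    have hcomb : ∀ c : Fin n → ℝ, ∑ k, c k • ∫ t in S, φ t (cfc (h k) (x t)) ∂μ =
        ∫ t in S, φ t (cfc (fun s => ∑ k, c k * h k s) (x t)) ∂μ := by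
      intro c
      simp_rw [hpt c]
      rw [integral_finsetSum _ fun k _ => (hcint c k).integrableOn]
      exact Finset.sum_congr rfl fun k _ => (integral_smul _ _).symm
    -- The index `none` carries the mass missing from `S`.
    let b : Option (Fin n) → B := fun o => o.elim c₀ fun k => ∫ t in S, φ t (cfc (h k) (x t)) ∂μ
    let w : Option (Fin n) → ℝ := fun o => o.elim r₀ r
    have hb : ∀ o, 0 ≤ b o := by
      rintro (_ | k)
      · exact sub_nonneg.2 hS1
      · refine integral_nonneg fun t => map_nonneg (φ t) (cfc_nonneg fun s _ => hh0 k s)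
    have hb1 : ∑ o, b o = 1 := by
      have h1 := hcomb fun _ => 1
      simp only [one_smul, one_mul, hh1] at h1
      rw [Fintype.sum_option]
      change c₀ + ∑ k, ∫ t in S, φ t (cfc (h k) (x t)) ∂μ = 1
      rw [h1]
      simp_rw [cfc_const_one ℝ (x _) (hsa _)]
      rw [hc₀, sub_add_cancel]
    have hw : ∀ o, w o ∈ Set.Icc p q := by
      rintro (_ | k)
      · exact hr₀
      · exact hr k
    have hsum : ∑ o, w o • b o = (∫ t in S, φ t (x t) ∂μ) + r₀ • c₀ := by
      rw [Fintype.sum_option, add_comm]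
      change (∑ k, r k • ∫ t in S, φ t (cfc (h k) (x t)) ∂μ) + r₀ • c₀ = _
      rw [hcomb r]
      congr 1
      refine setIntegral_congr_fun hS fun t ht => ?_
      have : cfc (fun s => ∑ k, r k * h k s) (x t) = x t := by
        conv_rhs => rw [← cfc_id ℝ (x t) (hsa t)]
        exact cfc_congr fun s hs => (happ s (hspec t ht hs)).1
      exact congr_arg (φ t) this
    have hmain := hf.cfc_sum_smul_le hH hb hb1 hpq hle hw
    have hspec' := (sum_smul_mem_Icc hb hb1 hw).2
    rw [hsum] at hmain hspec'
    refine ⟨hspec', hmain.trans ?_⟩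
    rw [Fintype.sum_option, add_comm]
    change (∑ k, f (r k) • ∫ t in S, φ t (cfc (h k) (x t)) ∂μ) + f r₀ • c₀ ≤ _
    rw [hcomb fun k => f (r k), add_right_comm]
    refine add_le_add ?_ le_rfl
    have hcomb_int : IntegrableOn (fun t => φ t (cfc (fun s => ∑ k, f (r k) * h k s) (x t)))
        S μ := by
      simp_rw [hpt]
      exact (integrable_finsetSum _ fun k _ => hcint (fun k => f (r k)) k).integrableOn
    calc ∫ t in S, φ t (cfc (fun s => ∑ k, f (r k) * h k s) (x t)) ∂μ
        ≤ ∫ t in S, (φ t (cfc f (x t)) + ε • φ t 1) ∂μ := by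
          refine setIntegral_mono_on hcomb_int
            (hfint.add (hint1 ε).integrableOn) hS fun t ht => ?_
          have hct := hcont.mono (hspec t ht)
          have h1 : cfc (fun s => ∑ k, f (r k) * h k s) (x t) ≤ cfc f (x t) + ε • 1 := by
            rw [← Algebra.algebraMap_eq_smul_one, ← cfc_const ε (x t) (hsa t),
              ← cfc_add _ _ _ hct (by fun_prop)]
            refine cfc_mono (fun s hs => (happ s (hspec t ht hs)).2) ?_ (by fun_prop)
            exact (continuous_finsetSum _ fun k _ =>
              continuous_const.mul (hhc k)).continuousOn
          have h2 : φ t (cfc (fun s => ∑ k, f (r k) * h k s) (x t)) ≤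
              φ t (cfc f (x t) + ε • 1) := by gcongr
          rwa [map_add, hsmul] at h2
      _ = (∫ t in S, φ t (cfc f (x t)) ∂μ) + ε • ∫ t in S, φ t 1 ∂μ := by
          rw [integral_add hfint (hint1 ε).integrableOn, integral_smul]
      _ ≤ (∫ t in S, φ t (cfc f (x t)) ∂μ) + ε • 1 :=
          add_le_add le_rfl (smul_le_smul_of_nonneg_left hS1 hε.le)
  refine ⟨(key 1 one_pos).1, ?_⟩
  have hlim : Tendsto (fun ε : ℝ => (∫ t in S, φ t (cfc f (x t)) ∂μ) + f r₀ • c₀ + ε • (1 : B))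
      (𝓝[>] 0) (𝓝 ((∫ t in S, φ t (cfc f (x t)) ∂μ) + f r₀ • c₀ + (0 : ℝ) • (1 : B))) :=
    ((continuous_const.add (continuous_id.smul continuous_const)).tendsto 0).mono_left
      nhdsWithin_le_nhds
  rw [zero_smul, add_zero] at hlim
  exact ge_of_tendsto hlim (eventually_mem_nhdsWithin.mono fun ε hε => (key ε hε).2)

end Jensen

end

/-! ### The inequality for all fields -/

section

open Filter Topology

section Jensen

variable {H : Type*} [NormedAddCommGroup H] [InnerProductSpace ℂ H] [CompleteSpace H]
  {I : Set ℝ} {f : ℝ → ℝ}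
  {A B : Type*} [CStarAlgebra A] [PartialOrder A] [StarOrderedRing A]
  [CStarAlgebra B] [PartialOrder B] [StarOrderedRing B]
  {T : Type*} [TopologicalSpace T] [T2Space T] [MeasurableSpace T] [BorelSpace T]
  {μ : Measure T} [IsFiniteMeasure μ] [μ.Regular] {φ : T → A →ₚ[ℂ] B}

/-- `I` is exhausted by compact intervals `[p n, q n]`; the inequality over the sets on which the
spectra lie in `[p n, q n]` passes to the limit, only the integrability of `φ t (f (x t))` being
needed. -/
lemma OperatorConvexOn.cfc_integral_le (hH : ¬ FiniteDimensional ℂ H) (hI : I.OrdConnected)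
    (hf : OperatorConvexOn H I f) (hφ : IsUnitalField μ φ) {x : T → A} (hx : Continuous x)
    (hsa : ∀ t, IsSelfAdjoint (x t)) (hspec : ∀ t, spectrum ℝ (x t) ⊆ I)
    (hint : Integrable (fun t => φ t (x t)) μ)
    (hfint : Integrable (fun t => φ t (cfc f (x t))) μ) :
    cfc f (∫ t, φ t (x t) ∂μ) ≤ ∫ t, φ t (cfc f (x t)) ∂μ := by
  rcases subsingleton_or_nontrivial B with hB | hB
  · exact (Subsingleton.elim _ _).le
  have hy : IsSelfAdjoint (∫ t, φ t (x t) ∂μ) := isSelfAdjoint_integral fun t => (hsa t).map (φ t)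
  have hyI := hφ.spectrum_integral_subset hI hx hsa hspec hint
  obtain ⟨r₀, hr₀⟩ := ContinuousFunctionalCalculus.spectrum_nonempty (R := ℝ) _ hy
  replace hr₀ : r₀ ∈ I := hyI hr₀
  have : Nonempty I := ⟨⟨r₀, hr₀⟩⟩
  obtain ⟨p, hp⟩ := exists_seq_tendsto (atBot : Filter I)
  obtain ⟨q, hq⟩ := exists_seq_tendsto (atTop : Filter I)
  have hev : ∀ a b : I, ∀ᶠ n in atTop, p n ≤ a ∧ b ≤ q n := fun a b =>
    (hp.eventually_le_atBot a).and (hq.eventually_ge_atTop b)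
  let S : ℕ → Set T := fun n =>
    {t | algebraMap ℝ A (p n) ≤ x t} ∩ {t | x t ≤ algebraMap ℝ A (q n)}
  have hS : ∀ n, MeasurableSet (S n) := fun n =>
    (measurableSet_algebraMap_le hx _).inter (measurableSet_le_algebraMap hx _)
  have hSspec : ∀ n t, t ∈ S n ↔ spectrum ℝ (x t) ⊆ Set.Icc (p n : ℝ) (q n) := fun n t =>
    (spectrum_subset_Icc_iff (hsa t)).symm
  have hmem : ∀ t, ∀ᶠ n in atTop, t ∈ S n := by
    intro t
    simp_rw [hSspec]
    rcases (spectrum ℝ (x t)).eq_empty_or_nonempty with h0 | h0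
    · simp [h0]
    have hcpt := ContinuousFunctionalCalculus.isCompact_spectrum (R := ℝ) (x t)
    obtain ⟨a, ha⟩ := hcpt.exists_isLeast h0
    obtain ⟨b, hb⟩ := hcpt.exists_isGreatest h0
    filter_upwards [hev ⟨a, hspec t ha.1⟩ ⟨b, hspec t hb.1⟩] with n hn r hr
    exact ⟨(show (p n : ℝ) ≤ a from hn.1).trans (ha.2 hr),
      (hb.2 hr).trans (show b ≤ (q n : ℝ) from hn.2)⟩
  obtain ⟨N, hN⟩ := eventually_atTop.1 (hev ⟨r₀, hr₀⟩ ⟨r₀, hr₀⟩)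
  have hlim0 : Tendsto (fun n => 1 - ∫ t in S n, φ t 1 ∂μ) atTop (𝓝 0) := by
    have := (tendsto_setIntegral_of_eventually_mem hφ.integrable_one hS hmem).const_sub 1
    rwa [hφ.integral_one, sub_self] at this
  have hlim : ∀ (g : T → B), Integrable g μ → ∀ r : ℝ,
      Tendsto (fun n => (∫ t in S n, g t ∂μ) + r • (1 - ∫ t in S n, φ t 1 ∂μ)) atTop
        (𝓝 (∫ t, g t ∂μ)) := by
    intro g hg r
    simpa using (tendsto_setIntegral_of_eventually_mem hg hS hmem).add (hlim0.const_smul r)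
  have hstep := fun n => hf.cfc_setIntegral_add_le hH hφ hx hsa (hS (n + N))
    (hI.out (p (n + N)).2 (q (n + N)).2) (hN (n + N) (Nat.le_add_left N n))
    (fun t ht => (hSspec (n + N) t).1 ht) hfint.integrableOn
  have hysa : ∀ n, IsSelfAdjoint
      ((∫ t in S n, φ t (x t) ∂μ) + r₀ • (1 - ∫ t in S n, φ t 1 ∂μ)) := fun n =>
    (isSelfAdjoint_integral fun t => (hsa t).map (φ t)).add <| (IsSelfAdjoint.all r₀).smul <|
      (IsSelfAdjoint.one B).sub <| isSelfAdjoint_integral fun t => (IsSelfAdjoint.one A).map (φ t)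
  have hleft := ((hlim _ hint r₀).comp (tendsto_add_atTop_nat N)).cfc_of_ordConnected hI hf.1
    (fun n => hysa (n + N)) (fun n => (hstep n).1.trans (hI.out (p (n + N)).2 (q (n + N)).2)) hy hyI
  exact le_of_tendsto_of_tendsto' hleft
    ((hlim _ hfint (f r₀)).comp (tendsto_add_atTop_nat N)) fun n => (hstep n).2

end Jensen

end

theorem theorem2p1
    {H : Type*} [NormedAddCommGroup H] [InnerProductSpace ℂ H] [CompleteSpace H]
    (hH : ¬ FiniteDimensional ℂ H)
    {I : Set ℝ} (hI : I.OrdConnected) {f : ℝ → ℝ} (hf : OperatorConvexOn H I f)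
    {A B : Type*}
    [CStarAlgebra A] [PartialOrder A] [StarOrderedRing A]
    [CStarAlgebra B] [PartialOrder B] [StarOrderedRing B]
    {T : Type*} [TopologicalSpace T] [LocallyCompactSpace T] [T2Space T]
    [MeasurableSpace T] [BorelSpace T]
    (μ : Measure T) [IsFiniteMeasure μ] [μ.Regular]
    (φ : T → A →ₚ[ℂ] B) (hφ : IsUnitalField μ φ)
    (x : T → A) (hx_cont : Continuous x) (hx_bdd : ∃ C : ℝ, ∀ t, ‖x t‖ ≤ C)
    (hx_sa : ∀ t, IsSelfAdjoint (x t)) (hx_spec : ∀ t, spectrum ℝ (x t) ⊆ I) :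
    -- the left-hand side is well defined
    (Integrable (fun t => φ t (x t)) μ ∧
      IsSelfAdjoint (∫ t, φ t (x t) ∂μ) ∧
      spectrum ℝ (∫ t, φ t (x t) ∂μ) ⊆ I) ∧
    -- the right-hand side is well defined as soon as the field `f (x t)` is bounded
    ((∃ C : ℝ, ∀ t, ‖cfc f (x t)‖ ≤ C) → Integrable (fun t => φ t (cfc f (x t))) μ) ∧
    -- whenever the right-hand side is well defined, the inequality holds
    (Integrable (fun t => φ t (cfc f (x t))) μ →
      cfc f (∫ t, φ t (x t) ∂μ) ≤ ∫ t, φ t (cfc f (x t)) ∂μ) := by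
  have hint : Integrable (fun t => φ t (x t)) μ := hφ.integrable_apply_field hx_cont hx_sa hx_bdd
  refine ⟨⟨hint, isSelfAdjoint_integral fun t => (hx_sa t).map (φ t),
    hφ.spectrum_integral_subset hI hx_cont hx_sa hx_spec hint⟩, fun hbdd => ?_, fun hfint => ?_⟩
  · exact hφ.integrable_apply_field (hx_cont.cfc_of_ordConnected hI hf.1 hx_sa hx_spec)
      (fun t => cfc_predicate f (x t)) hbdd
  · exact hf.cfc_integral_le hH hI hφ hx_cont hx_sa hx_spec hint hfint
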